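/- Let $A$ be a (not necessarily unital) $C^*$-algebra with center $Z(A)$, and let $\mathrm{Prim}(A)$ be the set of its primitive ideals (kernels of nonzero irreducible $*$-representations on Hilbert spaces) with the hull-kernel topology. Call $A$ quasicentral if no primitive ideal of $A$ contains $Z(A)$. Write $P_1\approx P_2$ for $P_1,P_2\in\mathrm{Prim}(A)$ if $f(P_1)=f(P_2)$ for every bounded continuous $f:\mathrm{Prim}(A)\to\mathbb{R}$. Let $\mathrm{Glimm}(A)$ be the set of the ideals $q_A(P)=\bigcap\{Q\in\mathrm{Prim}(A) : Q\approx P\}$, $P\in\mathrm{Prim}(A)$, and let $\tau_{cr}$ be the weakest topology on $\mathrm{Glimm}(A)$ for which every function $g:\mathrm{Glimm}(A)\to\mathbb{R}$ with $g\circ q_A$ bounded and continuous on $\mathrm{Prim}(A)$ is continuous. Suppose that $A$ is quasicentral and has a countable approximate identity, i.e. there is a sequence $(e_n)$ in $A$ with $e_na\to a$ and $ae_n\to a$ for all $a\in A$. Then there is an element $z\in Z(A)$ that is strictly positive for $A$ (that is, $z\ge 0$ and $zAz$ is dense in $A$), and such that for every $\tau_{cr}$-compact set $K\subset\mathrm{Glimm}(A)$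 there is $\alpha>0$ with $$K\subset\{G\in\mathrm{Glimm}(A) : \|z+G\|\ge\alpha\},$$ where $\|z+G\|$ is the norm of the image of $z$ in $A/G$. -/

import Mathlib

universe u

noncomputable section

namespace GlimmSpace

/-- A `*`-representation of `A` on a Hilbert space `H` is irreducible if it is nonzero and the only
closed invariant subspaces are `0` and `H`. -/
def IsIrreducibleRep {A : Type*} [NonUnitalCStarAlgebra A]
    {H : Type*} [NormedAddCommGroup H] [InnerProductSpace ℂ H] [CompleteSpace H]
    (π : A →⋆ₙₐ[ℂ] (H →L[ℂ] H)) : Prop :=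
  (∃ a, π a ≠ 0) ∧
    ∀ M : Submodule ℂ H, IsClosed (M : Set H) → (∀ a, ∀ x ∈ M, π a x ∈ M) → M = ⊥ ∨ M = ⊤

/-- A primitive ideal of `A` is the kernel of an irreducible `*`-representation. Every irreducible
representation of `A` is cyclic, so Hilbert spaces in the universe of `A` suffice. -/
def IsPrimitiveIdeal {A : Type u} [NonUnitalCStarAlgebra A] (P : Submodule ℂ A) : Prop :=
  ∃ (H : Type u) (_ : NormedAddCommGroup H) (_ : InnerProductSpace ℂ H) (_ : CompleteSpace H)
    (π : A →⋆ₙₐ[ℂ] (H →L[ℂ] H)), IsIrreducibleRep π ∧ ∀ a, a ∈ P ↔ π a = 0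

/-- `Prim(A)`, the set of primitive ideals of `A`. -/
def Prim (A : Type u) [NonUnitalCStarAlgebra A] : Type u :=
  {P : Submodule ℂ A // IsPrimitiveIdeal P}

variable {A : Type u} [NonUnitalCStarAlgebra A]

/-- The hull of a subset of `A`: all primitive ideals that contain it. -/
def hull (S : Set A) : Set (Prim A) := {P | S ⊆ (P.1 : Set A)}

/-- Primitive ideals are prime. -/
theorem IsPrimitiveIdeal.prime {P : Submodule ℂ A} (hP : IsPrimitiveIdeal P) {x y : A}
    (h : ∀ a, x * a * y ∈ P) : x ∈ P ∨ y ∈ P := by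
  obtain ⟨H, _, _, _, π, ⟨⟨b, hb⟩, hirr⟩, hker⟩ := hP
  by_contra! hxy
  obtain ⟨hx, hy⟩ := hxy
  rw [hker] at hx hy
  -- vectors killed by `π(x)π(A)`
  let N : Submodule ℂ H :=
    { carrier := {v | ∀ a, π x (π a v) = 0}
      add_mem' := fun {v w} hv hw a => by
        have h1 := hv a
        have h2 := hw a
        simp [h1, h2]
      zero_mem' := fun a => by simp
      smul_mem' := fun c v hv a => by
        have h1 := hv a
        simp [h1] }
  have hNc : IsClosed (N : Set H) := by
    have : (N : Set H) = ⋂ a, {v | π x (π a v) = 0} := by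
      ext v; simp [N]
    rw [this]
    exact isClosed_iInter fun a => isClosed_eq (by fun_prop) continuous_const
  have hNi : ∀ a, ∀ v ∈ N, π a v ∈ N := fun a v hv c => by
    have := hv (c * a)
    simpa [map_mul] using this
  have hyN : ∀ v, π y v ∈ N := fun v a => by
    have h1 : π (x * a * y) = 0 := (hker _).1 (h a)
    have h2 : π (x * a * y) v = 0 := by rw [h1]; rfl
    simpa [map_mul] using h2
  rcases hirr N hNc hNi with h0 | h1
  · refine hy (ContinuousLinearMap.ext fun v => ?_)
    have := hyN v
    rw [h0] at this
    simpa using this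
  · -- `π(x)` vanishes on `π(A)H`, whose closed span is all of `H`
    let M : Submodule ℂ H := (Submodule.span ℂ {w | ∃ a v, w = π a v}).topologicalClosure
    have hMi : ∀ a, ∀ w ∈ M, π a w ∈ M := fun a w _ =>
      Submodule.le_topologicalClosure _ (Submodule.subset_span ⟨a, w, rfl⟩)
    rcases hirr M (Submodule.isClosed_topologicalClosure _) hMi with hM | hM
    · refine hb (ContinuousLinearMap.ext fun v => ?_)
      have : π b v ∈ M := Submodule.le_topologicalClosure _ (Submodule.subset_span ⟨b, v, rfl⟩)
      rw [hM] at this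
      simpa using this
    · have hle : M ≤ LinearMap.ker (π x).toLinearMap := by
        refine Submodule.topologicalClosure_minimal _ (Submodule.span_le.2 ?_)
          (ContinuousLinearMap.isClosed_ker (π x))
        rintro w ⟨a, v, rfl⟩
        have : v ∈ N := by rw [h1]; trivial
        exact this a
      refine hx (ContinuousLinearMap.ext fun v => ?_)
      have : v ∈ M := by rw [hM]; trivial
      exact hle this

/-- Primitive ideals are two-sided ideals. -/
theorem IsPrimitiveIdeal.mul_mem {P : Submodule ℂ A} (hP : IsPrimitiveIdeal P) {x : A}
    (hx : x ∈ P) (a b : A) : a * x ∈ P ∧ x * b ∈ P := by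
  obtain ⟨H, _, _, _, π, -, hker⟩ := hP
  rw [hker] at hx
  simp [hker, hx]

/-- The hull-kernel topology on `Prim(A)`: the closed sets are exactly the hulls. -/
instance : TopologicalSpace (Prim A) :=
  TopologicalSpace.ofClosed {C | ∃ S : Set A, C = hull S}
    (by
      obtain h : (∅ : Set (Prim A)) = hull Set.univ := by
        refine (Set.eq_empty_of_forall_notMem fun P hP => ?_).symm
        obtain ⟨H, _, _, _, π, ⟨⟨b, hb⟩, -⟩, hker⟩ := P.2
        exact hb ((hker b).1 (hP trivial))
      exact ⟨_, h⟩)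
    (by
      intro 𝒞 h𝒞
      refine ⟨{a | ∃ S : Set A, hull S ∈ 𝒞 ∧ a ∈ S}, ?_⟩
      ext P
      constructor
      · rintro hP a ⟨S, hS, ha⟩
        exact hP _ hS ha
      · intro hP C hC
        obtain ⟨S, rfl⟩ := h𝒞 hC
        exact fun a ha => hP ⟨S, hC, ha⟩)
    (by
      rintro _ ⟨S, rfl⟩ _ ⟨T, rfl⟩
      refine ⟨{c | ∃ x ∈ S, ∃ a, ∃ y ∈ T, c = x * a * y}, ?_⟩
      ext P
      constructor
      · rintro (hP | hP) c ⟨x, hx, a, y, hy, rfl⟩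
        · exact (P.2.mul_mem ((P.2.mul_mem (hP hx) a a).2) y y).2
        · exact (P.2.mul_mem (hP hy) (x * a) a).1
      · intro hP
        by_contra hcon
        simp only [Set.mem_union, not_or] at hcon
        obtain ⟨x, hx, hxP⟩ := Set.not_subset.1 hcon.1
        obtain ⟨y, hy, hyP⟩ := Set.not_subset.1 hcon.2
        rcases P.2.prime (x := x) (y := y) fun a => hP ⟨x, hx, a, y, hy, rfl⟩ with h | h
        · exact hxP h
        · exact hyP h)

theorem isClosed_iff_hull {C : Set (Prim A)} : IsClosed C ↔ ∃ S : Set A, C = hull S := by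
  rw [← isOpen_compl_iff]
  change Cᶜᶜ ∈ {C | ∃ S : Set A, C = hull S} ↔ _
  rw [compl_compl]
  rfl

/-- `P₁ ≈ P₂`: the bounded continuous real functions on `Prim(A)` do not separate `P₁`, `P₂`. -/
def Equivalent (P₁ P₂ : Prim A) : Prop :=
  ∀ f : BoundedContinuousFunction (Prim A) ℝ, f P₁ = f P₂

/-- The kernel (intersection) of the equivalence class of `P`. -/
def glimmIdeal (P : Prim A) : Submodule ℂ A :=
  ⨅ Q : {Q : Prim A // Equivalent Q P}, Q.1.1

variable (A) in
/-- `Glimm(A)`, the set of kernels of equivalence classes of primitive ideals. -/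
def Glimm : Type u := {G : Submodule ℂ A // ∃ P : Prim A, G = glimmIdeal P}

/-- The quotient map `q_A : Prim(A) → Glimm(A)`. -/
def quotientMap (P : Prim A) : Glimm A := ⟨glimmIdeal P, P, rfl⟩

/-- Every bounded continuous real function on `Prim(A)` drops to `Glimm(A)`. -/
theorem exists_drop (f : BoundedContinuousFunction (Prim A) ℝ) :
    ∃ g : Glimm A → ℝ, ∀ P, g (quotientMap P) = f P := by
  have key : ∀ P₁ P₂ : Prim A, glimmIdeal P₁ = glimmIdeal P₂ → f P₁ = f P₂ := by
    intro P₁ P₂ h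
    have hc : IsClosed {Q : Prim A | f Q = f P₁} := isClosed_eq f.continuous continuous_const
    obtain ⟨S, hS⟩ := isClosed_iff_hull.1 hc
    have h1 : S ⊆ (glimmIdeal P₁ : Set A) := by
      intro a ha
      refine (Submodule.mem_iInf _).2 fun Q => ?_
      have : Q.1 ∈ hull S := by rw [← hS]; exact Q.2 f
      exact this ha
    have h2 : P₂ ∈ hull S := fun a ha => by
      have := h1 ha
      rw [h] at this
      exact (Submodule.mem_iInf _).1 this ⟨P₂, fun _ => rfl⟩
    rw [← hS] at h2
    exact h2.symm
  refine ⟨fun G => f G.2.choose, fun P => key _ _ ?_⟩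
  exact (quotientMap P).2.choose_spec.symm

/-- The topology `τ_cr`: the weakest topology on `Glimm(A)` making continuous all functions `g`
obtained by dropping to `Glimm(A)` a bounded continuous real function on `Prim(A)`, that is, all `g`
such that `g ∘ q_A` is a bounded continuous function `f` on `Prim(A)`. -/
instance : TopologicalSpace (Glimm A) :=
  ⨅ g : {g : Glimm A → ℝ // ∃ f : BoundedContinuousFunction (Prim A) ℝ, ∀ P, g (quotientMap P) = f P},
    TopologicalSpace.induced g.1 inferInstance

variable (A) in
/-- `A` is quasicentral if no primitive ideal contains the center of `A`. -/
def IsQuasicentral : Prop := ∀ P : Prim A, ¬ Set.center A ⊆ (P.1 : Set A)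

variable (A) in
/-- `A` has a countable approximate identity: a sequence `e` with `e n * a → a` and
`a * e n → a` for all `a`. -/
def HasCountableApproximateIdentity : Prop :=
  ∃ e : ℕ → A, (Filter.map e Filter.atTop).IsApproximateUnit

/-- `a` is strictly positive for `A`: it is positive and `aAa` is dense in `A`. -/
def IsStrictlyPositiveFor [PartialOrder A] (a : A) : Prop :=
  0 ≤ a ∧ Dense {y : A | ∃ x : A, y = a * x * a}

end GlimmSpace

end

/-
Modulo a primitive ideal `P` a central element `z` is a scalar `χ_P(z)`, by Schur's lemma, and
`P ↦ χ_P(z)` is continuous because `χ_P(z)` lies in a closed set `C` exactly when `P` contains the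
elements `f(z)a`, where `f` is the distance to `C`. Hence `|χ_P(z)|` drops to a continuous function
on `Glimm(A)`. It bounds the norm of `z` modulo `q_A(P)` from below, and it vanishes nowhere if `z`
lies in no primitive ideal; it is then bounded away from `0` on a compact set.

To find such a `z`, note that a closed ideal contained in no primitive ideal is all of `A`. This
rests on the existence of irreducible representations, which come from the extreme points of the
state space by the GNS construction. So if `A` is quasicentral, `Z(A)` generates `A` as a closed
ideal, and an approximate unit `(e_n)` is generated by countably many central elements `w_n`; with
weights that make the series converge, `z = ∑ c_n w_n^* w_n` lies in no primitive ideal. Since then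
`z ^ 2` generates `A` too, `zAz = z ^ 2 A` is dense.
-/

namespace GlimmSpace

open scoped ComplexOrder CStarAlgebra InnerProductSpace Pointwise

/-- The closed two-sided ideals of a C⋆-algebra, the ideals for which quotients are formed. That
such an ideal is closed under the adjoint is automatic, but it is included here as a field. -/
structure IsClosedStarIdeal {A : Type*} [NonUnitalCStarAlgebra A] (J : Submodule ℂ A) : Prop where
  isClosed : IsClosed (J : Set A)
  mul_mem_left : ∀ x, ∀ j ∈ J, x * j ∈ J
  mul_mem_right : ∀ x, ∀ j ∈ J, j * x ∈ J
  star_mem : ∀ j ∈ J, star j ∈ J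

section ApproximateUnit

variable {B : Type*} [CStarAlgebra B] [PartialOrder B] [StarOrderedRing B] {J : Submodule ℂ B}

theorem IsClosedStarIdeal.exists_norm_sub_mul_lt (hJ : IsClosedStarIdeal J) {j : B} (hj : j ∈ J)
    {ε : ℝ} (hε : 0 < ε) : ∃ e ∈ J, ‖1 - e‖ ≤ 1 ∧ ‖j - j * e‖ < ε := by
  let S : NonUnitalStarSubalgebra ℂ B :=
    { J with
      mul_mem' := fun {a b} _ hb => hJ.mul_mem_left a b hb
      star_mem' := fun {a} ha => hJ.star_mem a ha }
  have : IsClosed (S : Set B) := hJ.isClosed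
  let _ := CStarAlgebra.spectralOrder S
  have _ := CStarAlgebra.spectralOrderedRing S
  have hu := CStarAlgebra.increasingApproximateUnit S
  have hlim := tendsto_iff_norm_sub_tendsto_zero.1 (hu.tendsto_mul_left ⟨j, hj⟩)
  obtain ⟨e, he_nonneg, he_norm, he⟩ := (hu.eventually_nonneg.and
    (hu.eventually_norm.and (hlim.eventually_lt_const hε))).exists
  have he_nonneg' : (0 : B) ≤ e := by
    obtain ⟨s, rfl⟩ := CStarAlgebra.nonneg_iff_eq_star_mul_self.1 he_nonneg
    exact star_mul_self_nonneg (s : B)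
  have he_le_one : (e : B) ≤ 1 := (CStarAlgebra.norm_le_one_iff_of_nonneg _).1 he_norm
  exact ⟨e, e.2,
    (CStarAlgebra.norm_le_one_iff_of_nonneg _ (sub_nonneg.2 he_le_one)).2
      (sub_le_self 1 he_nonneg'),
    by rwa [norm_sub_rev] at he⟩

theorem IsClosedStarIdeal.infDist_sq_le_norm (hJ : IsClosedStarIdeal J) (b : B) {p j : B}
    (hp : 0 ≤ p) (hj : j ∈ J) :
    Metric.infDist b (J : Set B) ^ 2 ≤ ‖star b * b + p + j‖ := by
  refine le_of_forall_pos_le_add fun ε hε => ?_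
  obtain ⟨e, he, he_one, hje⟩ := hJ.exists_norm_sub_mul_lt hj hε
  set c := 1 - e
  have hbc : b - b * e = b * c := by rw [mul_sub, mul_one]
  have hjc : j - j * e = j * c := by rw [mul_sub, mul_one]
  have norm_star_mul_le (x : B) : ‖star c * x‖ ≤ ‖x‖ :=
    (norm_mul_le _ _).trans (mul_le_of_le_one_left (norm_nonneg x) (by rwa [norm_star]))
  calc Metric.infDist b (J : Set B) ^ 2
      ≤ ‖b * c‖ ^ 2 := by
        rw [← hbc, ← dist_eq_norm]
        exact pow_le_pow_left₀ Metric.infDist_nonneg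
          (Metric.infDist_le_dist_of_mem (hJ.mul_mem_left b e he)) 2
    _ = ‖star c * (star b * b) * c‖ := by
        rw [sq, ← CStarRing.norm_star_mul_self, star_mul]
        simp only [mul_assoc]
    _ ≤ ‖star c * (star b * b + p) * c‖ :=
        CStarAlgebra.norm_le_norm_of_nonneg_of_le
          (star_left_conjugate_nonneg (star_mul_self_nonneg b) c)
          (star_left_conjugate_le_conjugate (le_add_of_nonneg_right hp) c)
    _ = ‖star c * ((star b * b + p + j) * c) - star c * (j * c)‖ := by
        rw [← mul_sub, ← sub_mul, add_sub_cancel_right, mul_assoc]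
    _ ≤ ‖(star b * b + p + j) * c‖ + ‖j * c‖ :=
        (norm_sub_le _ _).trans (add_le_add (norm_star_mul_le _) (norm_star_mul_le _))
    _ ≤ ‖star b * b + p + j‖ + ε :=
        add_le_add ((norm_mul_le _ _).trans (mul_le_of_le_one_right (norm_nonneg _) he_one))
          (hjc ▸ hje.le)

end ApproximateUnit

section GNS

variable {B : Type*} [CStarAlgebra B] [PartialOrder B] [StarOrderedRing B] (φ : B →ₚ[ℂ] ℂ)

/-- The canonical cyclic vector of the GNS representation of a positive functional on a unital
C⋆-algebra. -/
noncomputable def gnsVector : φ.GNS := (φ.toPreGNS 1 : φ.PreGNS)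

theorem gnsStarAlgHom_gnsVector (x : B) :
    φ.gnsStarAlgHom x (gnsVector φ) = (φ.toPreGNS x : φ.PreGNS) := by
  refine φ.gnsNonUnitalStarAlgHom_apply_coe.trans ?_
  simp

theorem denseRange_gnsStarAlgHom_gnsVector :
    DenseRange fun x => φ.gnsStarAlgHom x (gnsVector φ) := by
  simp only [gnsStarAlgHom_gnsVector]
  exact UniformSpace.Completion.denseRange_coe.comp φ.toPreGNS.surjective.denseRange
    (UniformSpace.Completion.continuous_coe _)

theorem inner_gnsVector (x : B) : ⟪gnsVector φ, φ.gnsStarAlgHom x (gnsVector φ)⟫_ℂ = φ x := by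
  rw [gnsStarAlgHom_gnsVector, gnsVector, UniformSpace.Completion.inner_coe,
    φ.preGNS_inner_def, φ.ofPreGNS_toPreGNS, φ.ofPreGNS_toPreGNS, star_one, one_mul]

theorem norm_gnsVector_sq : ‖gnsVector φ‖ ^ 2 = ‖φ 1‖ := by
  rw [← inner_gnsVector φ 1, map_one, one_apply_eq_self, inner_self_eq_norm_sq_to_K]
  simp

theorem norm_apply_le_norm_apply_one_mul (x : B) : ‖φ x‖ ≤ ‖φ 1‖ * ‖x‖ :=
  calc ‖φ x‖ = ‖⟪gnsVector φ, φ.gnsStarAlgHom x (gnsVector φ)⟫_ℂ‖ := by rw [inner_gnsVector]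
    _ ≤ ‖gnsVector φ‖ * (‖φ.gnsStarAlgHom x‖ * ‖gnsVector φ‖) :=
      (norm_inner_le_norm _ _).trans (by gcongr; exact ContinuousLinearMap.le_opNorm _ _)
    _ ≤ ‖gnsVector φ‖ * (‖x‖ * ‖gnsVector φ‖) := by
      gcongr; exact NonUnitalStarAlgHom.norm_apply_le φ.gnsStarAlgHom x
    _ = ‖φ 1‖ * ‖x‖ := by rw [← norm_gnsVector_sq]; ring

theorem gnsStarAlgHom_eq_zero {x : B} (h : ∀ y z, φ (y * x * z) = 0) : φ.gnsStarAlgHom x = 0 := by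
  have hker : IsClosed {v | φ.gnsStarAlgHom x v = 0} := isClosed_eq (by fun_prop) continuous_const
  refine ContinuousLinearMap.ext fun v =>
    (denseRange_gnsStarAlgHom_gnsVector φ).induction_on v hker fun y => ?_
  rw [zero_apply, ← mul_apply_eq_comp, ← map_mul, gnsStarAlgHom_gnsVector,
    ← inner_self_eq_zero (𝕜 := ℂ), UniformSpace.Completion.inner_coe, φ.preGNS_inner_def,
    φ.ofPreGNS_toPreGNS, ← mul_assoc]
  exact h _ _

end GNS

section States

variable {B : Type*} [CStarAlgebra B] [PartialOrder B] {J : Submodule ℂ B}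

/-- The cone of positive functionals that vanish on `J`. -/
def posAnnihilator (J : Submodule ℂ B) : Set (WeakDual ℂ B) :=
  {f | (∀ x, 0 ≤ x → 0 ≤ f x) ∧ ∀ j ∈ J, f j = 0}

/-- The states that vanish on `J`: when `J` is an ideal, these are the states of `B ⧸ J`. -/
def stateSpace (J : Submodule ℂ B) : Set (WeakDual ℂ B) :=
  {f ∈ posAnnihilator J | f 1 = 1}

theorem smul_mem_posAnnihilator {f : WeakDual ℂ B} (hf : f ∈ posAnnihilator J) {c : ℂ}
    (hc : 0 ≤ c) : c • f ∈ posAnnihilator J :=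
  ⟨fun x hx => mul_nonneg hc (hf.1 x hx),
    fun j hj => (congrArg (c * ·) (hf.2 j hj)).trans (mul_zero c)⟩

theorem convex_stateSpace : Convex ℝ (stateSpace J) := by
  rintro f ⟨hf, hf_one⟩ g ⟨hg, hg_one⟩ s t hs ht hst
  refine ⟨⟨fun x hx => add_nonneg (smul_nonneg hs (hf.1 x hx)) (smul_nonneg ht (hg.1 x hx)),
    fun j hj => ?_⟩, ?_⟩
  · change s • f j + t • g j = 0
    rw [hf.2 j hj, hg.2 j hj, smul_zero, smul_zero, add_zero]
  · change s • f 1 + t • g 1 = 1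
    rw [hf_one, hg_one, ← add_smul, hst, one_smul]

variable [StarOrderedRing B]

theorem norm_apply_le_of_mem_posAnnihilator {f : WeakDual ℂ B} (hf : f ∈ posAnnihilator J)
    (x : B) : ‖f x‖ ≤ ‖f 1‖ * ‖x‖ :=
  norm_apply_le_norm_apply_one_mul
    (PositiveLinearMap.mk₀ (WeakDual.toStrongDual f).toLinearMap hf.1) x

theorem eq_zero_of_mem_posAnnihilator {f : WeakDual ℂ B} (hf : f ∈ posAnnihilator J)
    (h : f 1 = 0) : f = 0 :=
  DFunLike.ext _ _ fun x => norm_le_zero_iff.1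
    ((norm_apply_le_of_mem_posAnnihilator hf x).trans_eq (by rw [h, norm_zero, zero_mul]))

theorem inv_smul_mem_stateSpace {f : WeakDual ℂ B} (hf : f ∈ posAnnihilator J) (h : f 1 ≠ 0) :
    (f 1)⁻¹ • f ∈ stateSpace J :=
  ⟨smul_mem_posAnnihilator hf (inv_nonneg.2 (hf.1 1 zero_le_one)), inv_mul_cancel₀ h⟩

theorem isCompact_stateSpace : IsCompact (stateSpace J) := by
  have continuous_eval (x : B) : Continuous fun f : WeakDual ℂ B => f x :=
    WeakDual.eval_continuous x
  have isClosed_stateSpace : IsClosed (stateSpace J) := by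
    simp only [stateSpace, posAnnihilator, Set.ofPred_and, Set.ofPred_forall]
    exact ((isClosed_iInter fun x => isClosed_iInter fun _ =>
      isClosed_le continuous_const (continuous_eval x)).inter
        (isClosed_iInter fun j => isClosed_iInter fun _ =>
          isClosed_eq (continuous_eval j) continuous_const)).inter
      (isClosed_eq (continuous_eval 1) continuous_const)
  refine (WeakDual.isCompact_closedBall (𝕜 := ℂ) (E := B) 0 1).of_isClosed_subset
    isClosed_stateSpace fun f hf => ?_
  rw [Set.mem_preimage, mem_closedBall_zero_iff]
  refine ContinuousLinearMap.opNorm_le_bound _ zero_le_one fun x => ?_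
  have := norm_apply_le_of_mem_posAnnihilator hf.1 x
  rwa [hf.2, norm_one] at this

theorem eq_smul_of_add_eq_of_mem_extremePoints {f g h : WeakDual ℂ B}
    (hf : f ∈ (stateSpace J).extremePoints ℝ) (hg : g ∈ posAnnihilator J)
    (hh : h ∈ posAnnihilator J) (hadd : g + h = f) : g = g 1 • f := by
  have add_one : g 1 + h 1 = 1 := by rw [← hf.1.2, ← hadd]; rfl
  by_cases hg_one : g 1 = 0
  · rw [hg_one, zero_smul, eq_zero_of_mem_posAnnihilator hg hg_one]
  by_cases hh_one : h 1 = 0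
  · rw [hh_one, add_zero] at add_one
    rw [add_one, one_smul, ← hadd, eq_zero_of_mem_posAnnihilator hh hh_one, add_zero]
  have re_smul_inv_smul {k : WeakDual ℂ B} (hk : k ∈ posAnnihilator J) (hk_one : k 1 ≠ 0) :
      (k 1).re • (k 1)⁻¹ • k = k := by
    refine DFunLike.ext _ _ fun x => ?_
    change (k 1).re • ((k 1)⁻¹ * k x) = k x
    rw [Complex.real_smul, ← Complex.eq_re_of_ofReal_le (r := 0) (hk.1 1 zero_le_one),
      mul_inv_cancel_left₀ hk_one]
  have re_pos {k : WeakDual ℂ B} (hk : k ∈ posAnnihilator J) (hk_one : k 1 ≠ 0) :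
      0 < (k 1).re :=
    (Complex.pos_iff.1 ((hk.1 1 zero_le_one).lt_of_ne' hk_one)).1
  have hseg : f ∈ openSegment ℝ ((g 1)⁻¹ • g) ((h 1)⁻¹ • h) := by
    refine ⟨(g 1).re, (h 1).re, re_pos hg hg_one, re_pos hh hh_one, ?_, ?_⟩
    · rw [← Complex.add_re, add_one, Complex.one_re]
    · rw [re_smul_inv_smul hg hg_one, re_smul_inv_smul hh hh_one, hadd]
  have heq : (g 1)⁻¹ • g = f := ((mem_extremePoints.1 hf).2 _ (inv_smul_mem_stateSpace hg hg_one)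
    _ (inv_smul_mem_stateSpace hh hh_one) hseg).1
  rw [← heq, smul_inv_smul₀ hg_one]

end States

section PureStates

variable {B : Type*} [CStarAlgebra B] {H : Type*} [NormedAddCommGroup H] [InnerProductSpace ℂ H]
  [CompleteSpace H] (π : B →⋆ₐ[ℂ] (H →L[ℂ] H))

theorem inner_map_eq_inner_map_star (x : B) (v w : H) : ⟪v, π x w⟫_ℂ = ⟪π (star x) v, w⟫_ℂ := by
  rw [map_star, ContinuousLinearMap.star_eq_adjoint, ContinuousLinearMap.adjoint_inner_left]

/-- The positive functional `x ↦ ⟪v, π x v⟫` given by a vector of a representation. It is a state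
if `v` is a unit vector. -/
noncomputable def vectorFunctional (v : H) : WeakDual ℂ B :=
  StrongDual.toWeakDual <| LinearMap.mkContinuous
    { toFun := fun x => ⟪v, π x v⟫_ℂ
      map_add' := by simp
      map_smul' := by simp }
    (‖v‖ * ‖v‖) fun x =>
      calc ‖⟪v, π x v⟫_ℂ‖ ≤ ‖v‖ * (‖π x‖ * ‖v‖) :=
            (norm_inner_le_norm _ _).trans (by gcongr; exact (π x).le_opNorm v)
        _ ≤ ‖v‖ * (‖x‖ * ‖v‖) := by gcongr; exact NonUnitalStarAlgHom.norm_apply_le π x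
        _ = ‖v‖ * ‖v‖ * ‖x‖ := by ring

theorem vectorFunctional_apply (v : H) (x : B) : vectorFunctional π v x = ⟪v, π x v⟫_ℂ := rfl

theorem eq_top_of_cyclic_mem {v : H} (hv : DenseRange fun x => π x v) {M : Submodule ℂ H}
    (hM : IsClosed (M : Set H)) (hinv : ∀ x, ∀ w ∈ M, π x w ∈ M) (h : v ∈ M) : M = ⊤ :=
  eq_top_iff.2 fun w _ => hv.induction_on w hM fun x => hinv x v h

theorem map_mem_orthogonal {M : Submodule ℂ H} (hinv : ∀ x, ∀ w ∈ M, π x w ∈ M) (x : B) :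
    ∀ w ∈ Mᗮ, π x w ∈ Mᗮ := fun w hw v hv => by
  rw [inner_map_eq_inner_map_star]
  exact hw _ (hinv _ v hv)

variable [PartialOrder B] [StarOrderedRing B] {J : Submodule ℂ B}

theorem vectorFunctional_mem_posAnnihilator (hJ : ∀ j ∈ J, π j = 0) (v : H) :
    vectorFunctional π v ∈ posAnnihilator J := by
  refine ⟨fun x hx => ?_, fun j hj => ?_⟩
  · obtain ⟨s, rfl⟩ := CStarAlgebra.nonneg_iff_eq_star_mul_self.1 hx
    rw [vectorFunctional_apply, map_mul, mul_apply_eq_comp, inner_map_eq_inner_map_star, star_star,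
      inner_self_eq_norm_sq_to_K]
    exact pow_nonneg (Complex.zero_le_real.2 (norm_nonneg (π s v))) 2
  · rw [vectorFunctional_apply, hJ j hj, zero_apply, inner_zero_right]

theorem eq_bot_or_eq_top_of_mem_extremePoints (hJ : ∀ j ∈ J, π j = 0) {v : H}
    (hv : DenseRange fun x => π x v)
    (hext : vectorFunctional π v ∈ (stateSpace J).extremePoints ℝ) {M : Submodule ℂ H}
    (hM : IsClosed (M : Set H)) (hinv : ∀ x, ∀ w ∈ M, π x w ∈ M) : M = ⊥ ∨ M = ⊤ := by
  have _ : CompleteSpace M := hM.completeSpace_coe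
  obtain ⟨v₁, hv₁, v₂, hv₂, rfl⟩ := M.exists_add_mem_mem_orthogonal v
  have inner_left (x : B) : ⟪v₁, π x (v₁ + v₂)⟫_ℂ = ⟪v₁, π x v₁⟫_ℂ := by
    rw [map_add, inner_add_right, map_mem_orthogonal π hinv x v₂ hv₂ v₁ hv₁, add_zero]
  have inner_right (x : B) : ⟪v₂, π x (v₁ + v₂)⟫_ℂ = ⟪v₂, π x v₂⟫_ℂ := by
    rw [map_add, inner_add_right, (M.mem_orthogonal' v₂).1 hv₂ _ (hinv x v₁ hv₁), zero_add]
  have hadd : vectorFunctional π v₁ + vectorFunctional π v₂ = vectorFunctional π (v₁ + v₂) :=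
    DFunLike.ext _ _ fun x => by
      change ⟪v₁, π x v₁⟫_ℂ + ⟪v₂, π x v₂⟫_ℂ = ⟪v₁ + v₂, π x (v₁ + v₂)⟫_ℂ
      rw [inner_add_left, inner_left, inner_right]
  have hsmul := eq_smul_of_add_eq_of_mem_extremePoints hext
    (vectorFunctional_mem_posAnnihilator π hJ v₁) (vectorFunctional_mem_posAnnihilator π hJ v₂) hadd
  set c := vectorFunctional π v₁ 1
  have hv₁_eq : v₁ = star c • (v₁ + v₂) := hv.eq_of_inner_left ℂ fun x =>
    calc ⟪v₁, π x (v₁ + v₂)⟫_ℂ = c * ⟪v₁ + v₂, π x (v₁ + v₂)⟫_ℂ :=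
          (inner_left x).trans (DFunLike.congr_fun hsmul x)
      _ = ⟪star c • (v₁ + v₂), π x (v₁ + v₂)⟫_ℂ := by
          rw [inner_smul_left, starRingEnd_apply, star_star]
  by_cases hc : star c = 0
  · rw [hc, zero_smul] at hv₁_eq
    refine .inl (M.orthogonal_eq_top_iff.1 (eq_top_of_cyclic_mem π hv M.isClosed_orthogonal
      (map_mem_orthogonal π hinv) ?_))
    rwa [hv₁_eq, zero_add]
  · exact .inr (eq_top_of_cyclic_mem π hv hM hinv ((M.smul_mem_iff hc).1 (hv₁_eq ▸ hv₁)))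

end PureStates

section Separation

variable {B : Type*} [CStarAlgebra B] [PartialOrder B] [StarOrderedRing B] {J : Submodule ℂ B}

theorem IsClosedStarIdeal.neg_star_mul_self_notMem_closure (hJ : IsClosedStarIdeal J) {b : B}
    (hb : b ∉ J) : -(star b * b) ∉
      closure ((PointedCone.positive ℝ B ⊔ J.restrictScalars _ : PointedCone ℝ B) : Set B) := by
  have infDist_pos : 0 < Metric.infDist b (J : Set B) :=
    (hJ.isClosed.notMem_iff_infDist_pos ⟨0, J.zero_mem⟩).1 hb
  intro hmem
  obtain ⟨c, hc, hdist⟩ := Metric.mem_closure_iff.1 hmem _ (pow_pos infDist_pos 2)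
  obtain ⟨p, hp, j, hj, rfl⟩ := Submodule.mem_sup.1 hc
  refine (hJ.infDist_sq_le_norm b hp hj).not_gt ?_
  rwa [dist_comm, dist_eq_norm, sub_neg_eq_add, add_comm, ← add_assoc] at hdist

theorem IsClosedStarIdeal.exists_real_functional (hJ : IsClosedStarIdeal J) {b : B} (hb : b ∉ J) :
    ∃ f : StrongDual ℝ B, (∀ x, 0 ≤ x → 0 ≤ f x) ∧ (∀ j ∈ J, f j = 0) ∧ 0 < f (star b * b) := by
  obtain ⟨f, hf_nonneg, hf_neg⟩ := ProperCone.hyperplane_separation_point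
    (C := Submodule.closure (PointedCone.positive ℝ B ⊔ J.restrictScalars _))
    (hJ.neg_star_mul_self_notMem_closure hb)
  have nonneg_of_mem {x : B}
      (hx : x ∈ (PointedCone.positive ℝ B ⊔ J.restrictScalars _ : PointedCone ℝ B)) : 0 ≤ f x :=
    hf_nonneg x (subset_closure hx)
  have nonneg_of_mem_ideal {j : B} (hj : j ∈ J) : 0 ≤ f j :=
    nonneg_of_mem (Submodule.mem_sup_right hj)
  refine ⟨f, fun x hx => nonneg_of_mem (Submodule.mem_sup_left hx), fun j hj => ?_, ?_⟩
  · exact le_antisymm (neg_nonneg.1 (map_neg f j ▸ nonneg_of_mem_ideal (J.neg_mem hj)))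
      (nonneg_of_mem_ideal hj)
  · rwa [map_neg, neg_lt_zero] at hf_neg

theorem exists_mem_posAnnihilator_re_apply (hJ : ∀ j ∈ J, star j ∈ J) {f : StrongDual ℝ B}
    (hf : ∀ x, 0 ≤ x → 0 ≤ f x) (hfJ : ∀ j ∈ J, f j = 0) :
    ∃ g ∈ posAnnihilator J, ∀ x, (g x).re = f x + f (star x) := by
  let h : StrongDual ℝ B := f + f.comp (starL' ℝ : B ≃L[ℝ] B).toContinuousLinearMap
  have h_apply (x : B) : h x = f x + f (star x) := rfl
  let g : StrongDual ℂ B := h.extendRCLike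
  have re_apply (x : B) : (g x).re = h x := h.re_extendRCLike_apply (𝕜 := ℂ) x
  have im_apply (x : B) : (g x).im = -h (Complex.I • x) := h.im_extendRCLike_apply (𝕜 := ℂ) x
  refine ⟨StrongDual.toWeakDual g, ⟨fun x hx => ?_, fun j hj => ?_⟩, re_apply⟩
  · have star_I_smul : star (Complex.I • x) = -(Complex.I • x) := by
      rw [star_smul, (IsSelfAdjoint.of_nonneg hx).star_eq, Complex.star_def, Complex.conj_I,
        neg_smul]
    refine Complex.nonneg_iff.2 ⟨?_, ?_⟩
    · change 0 ≤ (g x).re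
      rw [re_apply, h_apply, (IsSelfAdjoint.of_nonneg hx).star_eq]
      exact add_nonneg (hf x hx) (hf x hx)
    · change 0 = (g x).im
      rw [im_apply, h_apply, star_I_smul, map_neg, add_neg_cancel, neg_zero]
  · have h_eq_zero {j : B} (hj : j ∈ J) : h j = 0 := by
      rw [h_apply, hfJ j hj, hfJ _ (hJ j hj), add_zero]
    refine Complex.ext ?_ ?_
    · exact (re_apply j).trans (h_eq_zero hj)
    · refine (im_apply j).trans ?_
      rw [h_eq_zero (J.smul_mem _ hj), neg_zero, Complex.zero_im]

theorem IsClosedStarIdeal.exists_mem_stateSpace_apply_ne_zero (hJ : IsClosedStarIdeal J) {b : B}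
    (hb : b ∉ J) : ∃ f ∈ stateSpace J, f (star b * b) ≠ 0 := by
  obtain ⟨f, hf_nonneg, hfJ, hfb⟩ := hJ.exists_real_functional hb
  obtain ⟨g, hg, hgf⟩ := exists_mem_posAnnihilator_re_apply hJ.star_mem hf_nonneg hfJ
  have hgb : g (star b * b) ≠ 0 := fun h => by
    have := hgf (star b * b)
    rw [h, Complex.zero_re, star_mul, star_star] at this
    linarith
  have hg_one : g 1 ≠ 0 := fun h => hgb (by rw [eq_zero_of_mem_posAnnihilator hg h]; rfl)
  exact ⟨_, inv_smul_mem_stateSpace hg hg_one, mul_ne_zero (inv_ne_zero hg_one) hgb⟩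

instance {E : Type*} [AddCommGroup E] [Module ℂ E] [TopologicalSpace E] :
    LocallyConvexSpace ℝ (WeakDual ℂ E) :=
  inferInstanceAs (LocallyConvexSpace ℝ (WeakBilin (topDualPairing ℂ E)))

theorem IsClosedStarIdeal.exists_mem_extremePoints_apply_ne_zero (hJ : IsClosedStarIdeal J) {b : B}
    (hb : b ∉ J) : ∃ f ∈ (stateSpace J).extremePoints ℝ, f (star b * b) ≠ 0 := by
  by_contra! h
  obtain ⟨f, hf, hfb⟩ := hJ.exists_mem_stateSpace_apply_ne_zero hb
  refine hfb (closure_minimal (convexHull_min h ?_)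
    (isClosed_eq (WeakDual.eval_continuous (star b * b)) continuous_const)
    (?_ : f ∈ closure (convexHull ℝ ((stateSpace J).extremePoints ℝ))))
  · intro g hg k hk s t _ _ _
    change s • g (star b * b) + t • k (star b * b) = 0
    rw [hg, hk, smul_zero, smul_zero, add_zero]
  · have krein_milman : closure (convexHull ℝ ((stateSpace J).extremePoints ℝ)) = stateSpace J :=
      closure_convexHull_extremePoints isCompact_stateSpace convex_stateSpace
    exact krein_milman.ge hf

end Separation

section PrimitiveIdeals

variable {B : Type u} [CStarAlgebra B]

theorem IsClosedStarIdeal.exists_starAlgHom {J : Submodule ℂ B} (hJ : IsClosedStarIdeal J) {b : B}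
    (hb : b ∉ J) :
    ∃ (H : Type u) (_ : NormedAddCommGroup H) (_ : InnerProductSpace ℂ H) (_ : CompleteSpace H)
      (π : B →⋆ₐ[ℂ] (H →L[ℂ] H)), (∀ j ∈ J, π j = 0) ∧ π b ≠ 0 ∧
        ∀ M : Submodule ℂ H, IsClosed (M : Set H) → (∀ x, ∀ v ∈ M, π x v ∈ M) →
          M = ⊥ ∨ M = ⊤ := by
  let _ := CStarAlgebra.spectralOrder B
  have _ := CStarAlgebra.spectralOrderedRing B
  obtain ⟨f, hf, hfb⟩ := hJ.exists_mem_extremePoints_apply_ne_zero hb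
  let φ : B →ₚ[ℂ] ℂ := PositiveLinearMap.mk₀ (WeakDual.toStrongDual f).toLinearMap hf.1.1.1
  have vectorFunctional_gnsVector : vectorFunctional φ.gnsStarAlgHom (gnsVector φ) = f :=
    DFunLike.ext _ _ (inner_gnsVector φ)
  have map_ideal : ∀ j ∈ J, φ.gnsStarAlgHom j = 0 := fun j hj =>
    gnsStarAlgHom_eq_zero φ fun y z =>
      hf.1.1.2 _ (hJ.mul_mem_right z _ (hJ.mul_mem_left y j hj))
  refine ⟨φ.GNS, _, _, inferInstance, φ.gnsStarAlgHom, map_ideal, fun h => hfb ?_,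
    fun M => eq_bot_or_eq_top_of_mem_extremePoints _ map_ideal
      (denseRange_gnsStarAlgHom_gnsVector φ) (vectorFunctional_gnsVector.symm ▸ hf)⟩
  rw [← vectorFunctional_gnsVector, vectorFunctional_apply, map_mul, h, mul_zero, zero_apply,
    inner_zero_right]

variable {A : Type u} [NonUnitalCStarAlgebra A]

theorem IsClosedStarIdeal.map_inrHom {J : Submodule ℂ A} (hJ : IsClosedStarIdeal J) :
    IsClosedStarIdeal (J.map (Unitization.inrHom ℂ ℂ A)) where
  isClosed :=
    (Unitization.isometry_inr (𝕜 := ℂ) (A := A)).isClosedEmbedding.isClosedMap _ hJ.isClosed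
  mul_mem_left := by
    rintro x _ ⟨j, hj, rfl⟩
    refine ⟨x.fst • j + x.snd * j, J.add_mem (J.smul_mem _ hj) (hJ.mul_mem_left _ _ hj), ?_⟩
    ext <;> simp
  mul_mem_right := by
    rintro x _ ⟨j, hj, rfl⟩
    refine ⟨x.fst • j + j * x.snd, J.add_mem (J.smul_mem _ hj) (hJ.mul_mem_right _ _ hj), ?_⟩
    ext <;> simp
  star_mem := by
    rintro _ ⟨j, hj, rfl⟩
    exact ⟨star j, hJ.star_mem j hj, Unitization.inr_star j⟩

theorem isIrreducibleRep_comp_inr {H : Type*} [NormedAddCommGroup H] [InnerProductSpace ℂ H]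
    [CompleteSpace H] (π : Unitization ℂ A →⋆ₐ[ℂ] (H →L[ℂ] H)) {a : A} (ha : π a ≠ 0)
    (hπ : ∀ M : Submodule ℂ H, IsClosed (M : Set H) → (∀ x, ∀ v ∈ M, π x v ∈ M) →
      M = ⊥ ∨ M = ⊤) :
    IsIrreducibleRep ((π : Unitization ℂ A →⋆ₙₐ[ℂ] (H →L[ℂ] H)).comp
      (Unitization.inrNonUnitalStarAlgHom ℂ A)) := by
  refine ⟨⟨a, ha⟩, fun M hM hinv => hπ M hM fun x v hv => ?_⟩
  induction x with
  | inl_add_inr r a =>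
    rw [map_add, add_apply, ← Unitization.algebraMap_eq_inl, AlgHomClass.commutes,
      ContinuousLinearMap.algebraMap_apply]
    exact M.add_mem (M.smul_mem r hv) (hinv a v hv)

theorem IsClosedStarIdeal.exists_prim {J : Submodule ℂ A} (hJ : IsClosedStarIdeal J) {b : A}
    (hb : b ∉ J) : ∃ P : Prim A, J ≤ P.1 ∧ b ∉ P.1 := by
  have inr_notMem : (b : Unitization ℂ A) ∉ J.map (Unitization.inrHom ℂ ℂ A) := by
    rintro ⟨j, hj, hjb⟩
    exact hb (Unitization.inr_injective hjb ▸ hj)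
  obtain ⟨H, _, _, _, π, hπJ, hπb, hπ⟩ := hJ.map_inrHom.exists_starAlgHom inr_notMem
  let ρ := (π : Unitization ℂ A →⋆ₙₐ[ℂ] (H →L[ℂ] H)).comp (Unitization.inrNonUnitalStarAlgHom ℂ A)
  exact ⟨⟨LinearMap.ker (ρ : A →ₗ[ℂ] (H →L[ℂ] H)), H, _, _, _, ρ,
    isIrreducibleRep_comp_inr π hπb hπ, fun _ => LinearMap.mem_ker⟩,
    fun j hj => hπJ _ ⟨j, hj, rfl⟩, hπb⟩

end PrimitiveIdeals

section Schur

variable {A H : Type*} [NonUnitalCStarAlgebra A] [NormedAddCommGroup H] [InnerProductSpace ℂ H]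
  [CompleteSpace H] {π : A →⋆ₙₐ[ℂ] (H →L[ℂ] H)}

theorem IsIrreducibleRep.nontrivial (hπ : IsIrreducibleRep π) : Nontrivial H := by
  obtain ⟨a, ha⟩ := hπ.1
  obtain ⟨v, hv⟩ := ContinuousLinearMap.exists_ne_zero ha
  exact nontrivial_of_ne _ _ hv

theorem IsIrreducibleRep.eq_zero_or_eq_zero (hπ : IsIrreducibleRep π) {S T : H →L[ℂ] H}
    (hS : ∀ a, Commute S (π a)) (hST : S * T = 0) : S = 0 ∨ T = 0 := by
  have hinv : ∀ a, ∀ v ∈ LinearMap.ker S.toLinearMap, π a v ∈ LinearMap.ker S.toLinearMap := by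
    intro a v (hv : S v = 0)
    change (S * π a) v = 0
    rw [hS a, mul_apply_eq_comp, hv, map_zero]
  rcases hπ.2 _ S.isClosed_ker hinv with hker | hker
  · refine .inr (ContinuousLinearMap.ext fun v => ?_)
    exact (Submodule.eq_bot_iff _).1 hker (T v) (DFunLike.congr_fun hST v)
  · exact .inl (ContinuousLinearMap.ext fun v => Submodule.eq_top_iff'.1 hker v)

theorem IsIrreducibleRep.subsingleton_spectrum (hπ : IsIrreducibleRep π) {T : H →L[ℂ] H}
    [IsStarNormal T] (hT : ∀ a, Commute T (π a)) : (spectrum ℂ T).Subsingleton := by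
  intro s hs t ht
  by_contra hst
  let bump (x y : ℂ) : ℂ := (max (dist s t / 2 - dist y x) 0 : ℝ)
  have continuous_bump (x : ℂ) : Continuous (bump x) := by fun_prop
  have bump_mul_bump (y : ℂ) : bump s y * bump t y = 0 := by
    rw [← Complex.ofReal_mul, Complex.ofReal_eq_zero, mul_eq_zero, max_eq_right_iff,
      max_eq_right_iff]
    by_contra! h
    linarith [dist_triangle_left s t y]
  have hstar (a : A) : Commute (star T) (π a) := by
    simpa only [map_star, star_star] using (hT (star a)).star_star
  have bump_self_ne_zero (x : ℂ) : bump x x ≠ 0 :=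
    Complex.ofReal_ne_zero.2 (lt_max_of_lt_left (by simpa using hst)).ne'
  have cfc_bump_ne_zero {x : ℂ} (hx : x ∈ spectrum ℂ T) : cfc (bump x) T ≠ 0 := fun h => by
    have hmem : bump x x ∈ spectrum ℂ (cfc (bump x) T) := by
      rw [cfc_map_spectrum (bump x) T (hf := (continuous_bump x).continuousOn)]
      exact ⟨x, hx, rfl⟩
    have _ := hπ.nontrivial
    rw [h, spectrum.zero_eq] at hmem
    exact bump_self_ne_zero x hmem
  refine (hπ.eq_zero_or_eq_zero (fun a => (hT a).cfc (hstar a) (bump s)) ?_).elim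
    (cfc_bump_ne_zero hs) (cfc_bump_ne_zero ht)
  rw [← cfc_mul (bump s) (bump t) T (continuous_bump s).continuousOn
    (continuous_bump t).continuousOn]
  simp only [bump_mul_bump, cfc_const_zero]

theorem IsIrreducibleRep.exists_eq_smul_one (hπ : IsIrreducibleRep π) {T : H →L[ℂ] H}
    [IsStarNormal T] (hT : ∀ a, Commute T (π a)) : ∃ c : ℂ, T = c • 1 := by
  have _ := hπ.nontrivial
  obtain ⟨c, hc⟩ := spectrum.nonempty T
  refine ⟨c, ?_⟩
  calc T = cfc id T := (cfc_id ℂ T).symm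
    _ = cfc (fun _ => c) T := cfc_congr fun x hx => hπ.subsingleton_spectrum hT hx hc
    _ = c • 1 := by rw [cfc_const c T, Algebra.algebraMap_eq_smul_one]

end Schur

section CentralCharacter

variable {A : Type u} [NonUnitalCStarAlgebra A]

theorem isStarNormal_of_mem_center {z : A} (hz : z ∈ Set.center A) : IsStarNormal z :=
  ⟨Semigroup.mem_center_iff.1 hz (star z)⟩

theorem IsIrreducibleRep.exists_map_eq_smul_one {H : Type*} [NormedAddCommGroup H]
    [InnerProductSpace ℂ H] [CompleteSpace H] {π : A →⋆ₙₐ[ℂ] (H →L[ℂ] H)} (hπ : IsIrreducibleRep π)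
    {z : A} (hz : z ∈ Set.center A) : ∃ c : ℂ, π z = c • 1 :=
  have _ := (isStarNormal_of_mem_center hz).map π
  hπ.exists_eq_smul_one fun a =>
    (show Commute z a from (Semigroup.mem_center_iff.1 hz a).symm).map π

theorem Prim.exists_mul_sub_smul_mem (P : Prim A) (z : Set.center A) :
    ∃ c : ℂ, ∀ a, (z : A) * a - c • a ∈ P.1 := by
  obtain ⟨H, _, _, _, π, hπ, hker⟩ := P.2
  obtain ⟨c, hc⟩ := hπ.exists_map_eq_smul_one z.2
  refine ⟨c, fun a => ?_⟩
  rw [hker, map_sub, map_mul, map_smul, hc, smul_mul_assoc, one_mul, sub_self]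

/-- The central character of a primitive ideal `P`: a central element acts on `A ⧸ P` as
multiplication by this scalar. -/
noncomputable def centralCharacter (z : Set.center A) (P : Prim A) : ℂ :=
  (P.exists_mul_sub_smul_mem z).choose

theorem map_eq_centralCharacter_smul_one {H : Type*} [NormedAddCommGroup H]
    [InnerProductSpace ℂ H] [CompleteSpace H] {π : A →⋆ₙₐ[ℂ] (H →L[ℂ] H)} (hπ : IsIrreducibleRep π)
    {P : Prim A} (hker : ∀ a, a ∈ P.1 ↔ π a = 0) (z : Set.center A) :
    π z = centralCharacter z P • 1 := by
  obtain ⟨c, hc⟩ := hπ.exists_map_eq_smul_one z.2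
  obtain ⟨a, ha⟩ := hπ.1
  have hmem := (hker _).1 ((P.exists_mul_sub_smul_mem z).choose_spec a)
  rw [map_sub, map_mul, map_smul, hc, smul_mul_assoc, one_mul, ← sub_smul,
    smul_eq_zero_iff_left ha, sub_eq_zero] at hmem
  rw [hc, hmem, centralCharacter]

theorem centralCharacter_eq_zero_iff {z : Set.center A} {P : Prim A} :
    centralCharacter z P = 0 ↔ (z : A) ∈ P.1 := by
  obtain ⟨H, _, _, _, π, hπ, hker⟩ := P.2
  have _ := hπ.nontrivial
  rw [hker, map_eq_centralCharacter_smul_one hπ hker, smul_eq_zero_iff_left one_ne_zero]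

theorem norm_centralCharacter_le {z : Set.center A} {P : Prim A} {a : A} (ha : a - z ∈ P.1) :
    ‖centralCharacter z P‖ ≤ ‖a‖ := by
  obtain ⟨H, _, _, _, π, hπ, hker⟩ := P.2
  have _ := hπ.nontrivial
  rw [hker, map_sub, sub_eq_zero, map_eq_centralCharacter_smul_one hπ hker] at ha
  calc ‖centralCharacter z P‖ = ‖π a‖ := by rw [ha, norm_smul, norm_one, mul_one]
    _ ≤ ‖a‖ := NonUnitalStarAlgHom.norm_apply_le π a

theorem map_add_cfcₙ_mul_eq {H : Type*} [NormedAddCommGroup H]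
    [InnerProductSpace ℂ H] [CompleteSpace H] {π : A →⋆ₙₐ[ℂ] (H →L[ℂ] H)} {z : A} [IsStarNormal z]
    {c : ℂ} (hz : π z = c • 1) {f : ℂ → ℂ} (hf : Continuous f) (a : A) :
    π (f 0 • a + cfcₙ (fun x => f x - f 0) z * a) = f c • π a := by
  have hg : Continuous fun x => f x - f 0 := by fun_prop
  have map_cfcₙ : π (cfcₙ (fun x => f x - f 0) z) = (f c - f 0) • 1 := by
    rw [NonUnitalStarAlgHomClass.map_cfcₙ π _ z hg.continuousOn (sub_self _) (map_continuous π),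
      cfcₙ_eq_cfc hg.continuousOn (sub_self _), hz, ← Algebra.algebraMap_eq_smul_one,
      cfc_algebraMap, Algebra.algebraMap_eq_smul_one]
  rw [map_add, map_smul, map_mul, map_cfcₙ, smul_mul_assoc, one_mul, ← add_smul, add_sub_cancel]

theorem continuous_centralCharacter (z : Set.center A) : Continuous (centralCharacter z) := by
  refine continuous_iff_isClosed.2 fun C hC => ?_
  rcases C.eq_empty_or_nonempty with rfl | hne
  · exact isClosed_empty
  have _ := isStarNormal_of_mem_center z.2
  let f (x : ℂ) : ℂ := (Metric.infDist x C : ℝ)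
  have hf : Continuous f := Complex.continuous_ofReal.comp (Metric.continuous_infDist_pt C)
  refine isClosed_iff_hull.2
    ⟨Set.range fun a => f 0 • a + cfcₙ (fun x => f x - f 0) (z : A) * a, Set.ext fun P => ?_⟩
  obtain ⟨H, _, _, _, π, hπ, hker⟩ := P.2
  obtain ⟨b, hb⟩ := hπ.1
  have hz := map_eq_centralCharacter_smul_one hπ hker z
  calc centralCharacter z P ∈ C ↔ f (centralCharacter z P) = 0 := by
        rw [Complex.ofReal_eq_zero, hC.mem_iff_infDist_zero hne]
    _ ↔ ∀ a, f (centralCharacter z P) • π a = 0 :=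
        ⟨fun h a => by rw [h, zero_smul], fun h => (smul_eq_zero_iff_left hb).1 (h b)⟩
    _ ↔ P ∈ hull _ := by
        rw [hull, Set.mem_ofPred_eq, Set.range_subset_iff]
        refine forall_congr' fun a => ?_
        rw [← map_add_cfcₙ_mul_eq hz hf, SetLike.mem_coe, hker]

end CentralCharacter

section CentralIdeals

variable {A : Type u} [NonUnitalCStarAlgebra A]

theorem Prim.isClosed (P : Prim A) : IsClosed (P.1 : Set A) := by
  obtain ⟨H, _, _, _, π, -, hker⟩ := P.2
  rw [show (P.1 : Set A) = {a | π a = 0} from Set.ext hker]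
  exact isClosed_eq (map_continuous π) continuous_const

theorem Prim.exists_notMem (P : Prim A) : ∃ a, a ∉ P.1 := by
  obtain ⟨H, _, _, _, π, ⟨⟨a, ha⟩, -⟩, hker⟩ := P.2
  exact ⟨a, fun h => ha ((hker a).1 h)⟩

theorem Prim.mem_of_forall_mul_mem (P : Prim A) {x : A} (h : ∀ a, x * a ∈ P.1) : x ∈ P.1 :=
  (P.2.prime fun a => (mul_assoc x a x).symm ▸ h (a * x)).elim id id

theorem Prim.mem_of_mul_self_mem (P : Prim A) {z : A} (hz : z ∈ Set.center A)
    (h : z * z ∈ P.1) : z ∈ P.1 := by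
  refine (P.2.prime fun a => ?_).elim id id
  rw [← Semigroup.mem_center_iff.1 hz, mul_assoc]
  exact (P.2.mul_mem h a a).1

theorem Prim.mem_of_star_mul_self_mem (P : Prim A) {x : A} (h : star x * x ∈ P.1) : x ∈ P.1 := by
  obtain ⟨H, _, _, _, π, -, hker⟩ := P.2
  rw [hker, map_mul, map_star, CStarRing.star_mul_self_eq_zero_iff] at h
  exact (hker x).2 h

theorem Prim.mem_of_nonneg_of_le [PartialOrder A] [StarOrderedRing A] (P : Prim A) {x y : A}
    (hx : 0 ≤ x) (hxy : x ≤ y) (hy : y ∈ P.1) : x ∈ P.1 := by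
  obtain ⟨H, _, _, _, π, -, hker⟩ := P.2
  rw [hker] at hy ⊢
  exact le_antisymm (hy ▸ OrderHomClass.mono π hxy) (map_nonneg π hx)

/-- The closed ideal generated by a set `W` of central elements. -/
def centralIdeal (W : Set A) : Submodule ℂ A :=
  (Submodule.span ℂ (W * Set.univ)).topologicalClosure

variable {W : Set A}

theorem mul_mem_centralIdeal {w : A} (hw : w ∈ W) (a : A) : w * a ∈ centralIdeal W :=
  Submodule.le_topologicalClosure _
    (Submodule.subset_span (Set.mul_mem_mul hw (Set.mem_univ a)))

theorem centralIdeal_le {J : Submodule ℂ A} (hJ : IsClosed (J : Set A))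
    (h : ∀ w ∈ W, ∀ a, w * a ∈ J) : centralIdeal W ≤ J := by
  refine Submodule.topologicalClosure_minimal _ (Submodule.span_le.2 ?_) hJ
  rintro _ ⟨w, hw, a, -, rfl⟩
  exact h w hw a

theorem centralIdeal_le_prim {P : Prim A} (h : W ⊆ (P.1 : Set A)) : centralIdeal W ≤ P.1 :=
  centralIdeal_le P.isClosed fun _ hw a => (P.2.mul_mem (h hw) a a).2

theorem isClosedStarIdeal_centralIdeal (hW : W ⊆ Set.center A) (hstar : ∀ w ∈ W, star w ∈ W) :
    IsClosedStarIdeal (centralIdeal W) := by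
  have hclosed : IsClosed (centralIdeal W : Set A) := Submodule.isClosed_topologicalClosure _
  have comm {w : A} (hw : w ∈ W) (a : A) : a * w = w * a := Semigroup.mem_center_iff.1 (hW hw) a
  refine ⟨hclosed, fun x => ?_, fun x => ?_, ?_⟩
  · refine centralIdeal_le (J := (centralIdeal W).comap (LinearMap.mulLeft ℂ x))
      (hclosed.preimage (continuous_const_mul x)) fun w hw a => ?_
    change x * (w * a) ∈ centralIdeal W
    rw [← mul_assoc, comm hw, mul_assoc]
    exact mul_mem_centralIdeal hw _
  · refine centralIdeal_le (J := (centralIdeal W).comap (LinearMap.mulRight ℂ x))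
      (hclosed.preimage (continuous_mul_const x)) fun w hw a => ?_
    change w * a * x ∈ centralIdeal W
    rw [mul_assoc]
    exact mul_mem_centralIdeal hw _
  · refine centralIdeal_le
      (J := (centralIdeal W).comap (starLinearEquiv ℂ : A ≃ₗ⋆[ℂ] A).toLinearMap)
      (hclosed.preimage continuous_star) fun w hw a => ?_
    change star (w * a) ∈ centralIdeal W
    rw [star_mul, comm (hstar w hw)]
    exact mul_mem_centralIdeal (hstar w hw) _

theorem centralIdeal_eq_top (hW : W ⊆ Set.center A) (hstar : ∀ w ∈ W, star w ∈ W)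
    (hP : ∀ P : Prim A, ¬ W ⊆ (P.1 : Set A)) : centralIdeal W = ⊤ := by
  by_contra h
  obtain ⟨b, hb⟩ : ∃ b, b ∉ centralIdeal W := by
    simpa only [Submodule.eq_top_iff', not_forall] using h
  obtain ⟨P, hWP, -⟩ := (isClosedStarIdeal_centralIdeal hW hstar).exists_prim hb
  exact hP P fun w hw => P.mem_of_forall_mul_mem fun a => hWP (mul_mem_centralIdeal hw a)

end CentralIdeals

section Countability

theorem exists_countable_mem_topologicalClosure_span {R M : Type*} [Semiring R] [AddCommMonoid M]
    [Module R M] [TopologicalSpace M] [FirstCountableTopology M] [ContinuousAdd M]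
    [ContinuousConstSMul R M] {S : Set M} {x : M}
    (hx : x ∈ (Submodule.span R S).topologicalClosure) :
    ∃ T ⊆ S, T.Countable ∧ x ∈ (Submodule.span R T).topologicalClosure := by
  obtain ⟨y, hy, hyx⟩ := mem_closure_iff_seq_limit.1 hx
  choose T hTS hyT using fun n => Submodule.mem_span_finite_of_mem_span (hy n)
  exact ⟨⋃ n, T n, Set.iUnion_subset hTS, Set.countable_iUnion fun n => (T n).countable_toSet,
    mem_closure_of_tendsto hyx <| .of_forall fun n =>
      Submodule.span_mono (Set.subset_iUnion_of_subset n subset_rfl) (hyT n)⟩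

theorem exists_pos_summable_smul {ι E : Type*} [Countable ι] [NormedAddCommGroup E]
    [NormedSpace ℝ E] [CompleteSpace E] (v : ι → E) :
    ∃ c : ι → ℝ, (∀ i, 0 < c i) ∧ Summable fun i => c i • v i := by
  have _ := Encodable.ofCountable ι
  obtain ⟨ε, hε, _, hsum, -⟩ := posSumOfEncodable one_pos ι
  have norm_pos (i : ι) : 0 < 1 + ‖v i‖ := by positivity
  refine ⟨fun i => ε i / (1 + ‖v i‖), fun i => div_pos (hε i) (norm_pos i),
    .of_norm_bounded hsum.summable fun i => ?_⟩
  rw [norm_smul, Real.norm_of_nonneg (div_pos (hε i) (norm_pos i)).le, div_mul_eq_mul_div,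
    div_le_iff₀ (norm_pos i)]
  exact mul_le_mul_of_nonneg_left (le_add_of_nonneg_left zero_le_one) (hε i).le

variable {A : Type u} [NonUnitalCStarAlgebra A]

theorem exists_countable_mem_centralIdeal {W : Set A} {x : A} (hx : x ∈ centralIdeal W) :
    ∃ V ⊆ W, V.Countable ∧ x ∈ centralIdeal V := by
  obtain ⟨T, hT, hT_countable, hxT⟩ := exists_countable_mem_topologicalClosure_span hx
  have _ := hT_countable.to_subtype
  choose w hw a _ hwa using fun t : T => hT t.2
  refine ⟨Set.range w, Set.range_subset_iff.2 hw, Set.countable_range w,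
    Submodule.topologicalClosure_mono (Submodule.span_mono fun t ht => ?_) hxT⟩
  exact ⟨w ⟨t, ht⟩, Set.mem_range_self _, a ⟨t, ht⟩, trivial, hwa ⟨t, ht⟩⟩

theorem IsQuasicentral.exists_countable (hq : IsQuasicentral A)
    (hA : HasCountableApproximateIdentity A) :
    ∃ V ⊆ Set.center A, V.Countable ∧ ∀ P : Prim A, ¬ V ⊆ (P.1 : Set A) := by
  obtain ⟨e, he⟩ := hA
  have center_generates : centralIdeal (Set.center A) = ⊤ :=
    centralIdeal_eq_top subset_rfl (fun _ => Set.star_mem_center) hq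
  choose V hV hV_countable he_mem using fun n =>
    exists_countable_mem_centralIdeal (x := e n) (center_generates ▸ Submodule.mem_top)
  refine ⟨⋃ n, V n, Set.iUnion_subset hV, Set.countable_iUnion hV_countable, fun P hP => ?_⟩
  have e_mem (n : ℕ) : e n ∈ P.1 :=
    centralIdeal_le_prim ((Set.subset_iUnion V n).trans hP) (he_mem n)
  obtain ⟨b, hb⟩ := P.exists_notMem
  exact hb (P.isClosed.mem_of_tendsto (Filter.tendsto_map'_iff.1 (he.tendsto_mul_right b))
    (.of_forall fun n => (P.2.mul_mem (e_mem n) b b).2))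

end Countability

section PositiveCentralElements

variable {A : Type u} [NonUnitalCStarAlgebra A]

theorem exists_nonneg_mem_center [PartialOrder A] [StarOrderedRing A] {V : Set A}
    (hV_countable : V.Countable) (hV : V ⊆ Set.center A)
    (hP : ∀ P : Prim A, ¬ V ⊆ (P.1 : Set A)) :
    ∃ z ∈ Set.center A, 0 ≤ z ∧ ∀ P : Prim A, z ∉ P.1 := by
  have _ := hV_countable.to_subtype
  obtain ⟨c, hc, hsum⟩ := exists_pos_summable_smul fun w : V => star (w : A) * w
  have term_nonneg (w : V) : 0 ≤ c w • (star (w : A) * w) :=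
    smul_nonneg (hc w).le (star_mul_self_nonneg _)
  refine ⟨∑' w : V, c w • (star (w : A) * w), Semigroup.mem_center_iff.2 fun a => ?_,
    tsum_nonneg term_nonneg, fun P hzP => ?_⟩
  · rw [← hsum.tsum_mul_left, ← hsum.tsum_mul_right]
    refine tsum_congr fun w => ?_
    rw [mul_smul_comm, smul_mul_assoc, Semigroup.mem_center_iff.1
      (Set.mul_mem_center (Set.star_mem_center (hV w.2)) (hV w.2))]
  · obtain ⟨w, hw, hwP⟩ := Set.not_subset.1 (hP P)
    have term_mem : c ⟨w, hw⟩ • (star w * w) ∈ P.1 :=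
      P.mem_of_nonneg_of_le (term_nonneg ⟨w, hw⟩)
        (hsum.le_tsum ⟨w, hw⟩ fun v _ => term_nonneg v) hzP
    exact hwP (P.mem_of_star_mul_self_mem
      (((P.1.restrictScalars ℝ).smul_mem_iff (hc _).ne').1 term_mem))

theorem isStrictlyPositiveFor_of_forall_notMem [PartialOrder A] [StarOrderedRing A] {z : A}
    (hz : z ∈ Set.center A) (hz_nonneg : 0 ≤ z) (hP : ∀ P : Prim A, z ∉ P.1) :
    IsStrictlyPositiveFor z := by
  have sq_generates : centralIdeal {z * z} = ⊤ := by
    refine centralIdeal_eq_top (Set.singleton_subset_iff.2 (Set.mul_mem_center hz hz)) ?_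
      fun P h => hP P (P.mem_of_mul_self_mem hz (h rfl))
    rintro w rfl
    rw [star_mul, (IsSelfAdjoint.of_nonneg hz_nonneg).star_eq]
    rfl
  have span_le : Submodule.span ℂ ({z * z} * Set.univ) ≤
      LinearMap.range (LinearMap.mulLeftRight ℂ (z, z)) := by
    refine Submodule.span_le.2 ?_
    rintro _ ⟨_, rfl, a, -, rfl⟩
    refine ⟨a, ?_⟩
    change z * a * z = z * z * a
    rw [mul_assoc, Semigroup.mem_center_iff.1 hz, mul_assoc]
  refine ⟨hz_nonneg, fun y => closure_mono (fun x hx => ?_) (sq_generates.ge Submodule.mem_top)⟩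
  obtain ⟨a, rfl⟩ := span_le hx
  exact ⟨a, rfl⟩

end PositiveCentralElements

section Glimm

variable {A : Type u} [NonUnitalCStarAlgebra A]

theorem glimmIdeal_le (P : Prim A) : glimmIdeal P ≤ P.1 :=
  iInf_le (fun Q : {Q : Prim A // Equivalent Q P} => Q.1.1) ⟨P, fun _ => rfl⟩

theorem continuous_of_comp_quotientMap {g : Glimm A → ℝ}
    (f : BoundedContinuousFunction (Prim A) ℝ) (h : ∀ P, g (quotientMap P) = f P) :
    Continuous g :=
  continuous_iInf_dom (i := ⟨g, f, h⟩) continuous_induced_dom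

theorem norm_centralCharacter_le_norm_mk (z : Set.center A) (P : Prim A) :
    ‖centralCharacter z P‖ ≤ ‖(Submodule.Quotient.mk z : A ⧸ glimmIdeal P)‖ := by
  refine le_of_forall_pos_lt_add fun ε hε => ?_
  obtain ⟨a, ha, ha_lt⟩ :=
    Submodule.Quotient.norm_mk_lt (Submodule.Quotient.mk z : A ⧸ glimmIdeal P) hε
  exact (norm_centralCharacter_le
    (glimmIdeal_le P ((Submodule.Quotient.eq _).1 ha))).trans_lt ha_lt

theorem exists_continuous_norm_centralCharacter (z : Set.center A) :
    ∃ g : Glimm A → ℝ, Continuous g ∧ ∀ P, g (quotientMap P) = ‖centralCharacter z P‖ := by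
  let f : BoundedContinuousFunction (Prim A) ℝ :=
    .ofNormedAddCommGroup (fun P => ‖centralCharacter z P‖) (continuous_centralCharacter z).norm
      ‖(z : A)‖ fun P => by
        rw [norm_norm]
        exact norm_centralCharacter_le (by rw [sub_self]; exact P.1.zero_mem)
  obtain ⟨g, hg⟩ := exists_drop f
  exact ⟨g, continuous_of_comp_quotientMap f hg, hg⟩

theorem exists_pos_le_norm_mk_of_isCompact {z : A} (hz : z ∈ Set.center A)
    (hP : ∀ P : Prim A, z ∉ P.1) {K : Set (Glimm A)} (hK : IsCompact K) :
    ∃ α : ℝ, 0 < α ∧ K ⊆ {G : Glimm A | α ≤ ‖(Submodule.Quotient.mk z : A ⧸ G.1)‖} := by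
  obtain ⟨g, hg, hg_apply⟩ := exists_continuous_norm_centralCharacter ⟨z, hz⟩
  have g_pos : ∀ G ∈ K, 0 < g G := by
    rintro ⟨_, P, rfl⟩ -
    exact (norm_pos_iff.2 (mt centralCharacter_eq_zero_iff.1 (hP P))).trans_eq (hg_apply P).symm
  obtain ⟨α, hα, hα_le⟩ := hK.exists_forall_le' hg.continuousOn g_pos
  refine ⟨α, hα, ?_⟩
  rintro ⟨_, P, rfl⟩ hPK
  exact (hα_le _ hPK).trans ((hg_apply P).trans_le (norm_centralCharacter_le_norm_mk ⟨z, hz⟩ P))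

end Glimm

end GlimmSpace

theorem mainTheorem2 {A : Type*} [NonUnitalCStarAlgebra A] [PartialOrder A] [StarOrderedRing A]
    (hq : GlimmSpace.IsQuasicentral A) (hA : GlimmSpace.HasCountableApproximateIdentity A) :
    ∃ z : A, z ∈ Set.center A ∧ GlimmSpace.IsStrictlyPositiveFor z ∧
      ∀ K : Set (GlimmSpace.Glimm A), IsCompact K →
        ∃ α : ℝ, 0 < α ∧
          K ⊆ {G : GlimmSpace.Glimm A | α ≤ ‖(Submodule.Quotient.mk z : A ⧸ G.1)‖} := by
  obtain ⟨V, hV, hV_countable, hVP⟩ := hq.exists_countable hA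
  obtain ⟨z, hz, hz_nonneg, hzP⟩ := GlimmSpace.exists_nonneg_mem_center hV_countable hV hVP
  exact ⟨z, hz, GlimmSpace.isStrictlyPositiveFor_of_forall_notMem hz hz_nonneg hzP,
    fun _ hK => GlimmSpace.exists_pos_le_norm_mk_of_isCompact hz hzP hK⟩
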